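/- **Theorem 3.2 (Weierstrass–Enneper decomposition, maximal surfaces).** Let $\mathbb L^3$ be $\mathbb R^3$ with the metric $dx^2+dy^2-dz^2$. A *maximal graph* over an open set $W\subset\mathbb R^2$ is a $C^2$ function $h:W\to\mathbb R$ with $h_x^2+h_y^2<1$ and $(1-h_x^2)h_{yy}+2h_xh_yh_{xy}+(1-h_y^2)h_{xx}=0$ on $W$. For an open convex set $\Omega\subset\mathbb C$ and $\zeta_0\in\Omega$, we say that the graph of $h$ over $W$ has *Weierstrass–Enneper data* $M$ with parameter $\zeta=\Phi(x,y)$ if $M$ is holomorphic and without zeros on $\Omega$, $\Phi:W\to\Omega$ is a bijection, smooth in both directions, and there are constants $x_0,y_0,z_0\in\mathbb R$ such that, for all $\zeta\in\Omega$ and $(x,y)=\Phi^{-1}(\zeta)$, $$x=x_0+\operatorname{Re}\int_{\zeta_0}^{\zeta}(1+w^2)M(w)\,dw,\quad y=y_0+\operatorname{Re}\int_{\zeta_0}^{\zeta}i(1-w^2)M(w)\,dw,\quad h(x,y)=z_0-\operatorname{Re}\int_{\zeta_0}^{\zeta}2wM(w)\,dw .$$ Let $z=z(x,y)$ be a maximal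 graph over an open set $U\subset\mathbb R^2$ whose Gauss map $(z_x,z_y,1)/\sqrt{1-z_x^2-z_y^2}$ is injective on $U$. Let $p\in U$ and $n\ge 1$. Then there are an open set $U'$ with $p\in U'\subset U$, an open convex set $\Omega\subset\mathbb C$, a point $\zeta_0\in\Omega$, a function $M$ and a map $\Phi:U'\to\Omega$ such that the graph of $z$ over $U'$ has Weierstrass–Enneper data $M$ with parameter $\zeta=\Phi(x,y)$, and such that the following hold. 1. There are functions $z_1,\dots,z_n$ on $U'$ with $$z=z_1+\dots+z_n\quad\text{on }U',$$ and a splitting $M=M_1+\dots+M_n$ on $\Omega$ such that, for each $i$, there is a maximal graph $h_i$ over some open set $W_i\subset\mathbb R^2$ which has Weierstrass–Enneper data $M_i$ on the same $\Omega$ (with the same $\zeta_0$) with parameter $\zeta=\Phi_i(x_i,y_i)$, $(x_i,y_i)\in W_i$, and $z_i=h_i\circ\Phi_i^{-1}\circ\Phi$ on $U'$. Thus, after the invertible change of coordinates $(x_i,y_i)=\Phi_i^{-1}(\Phi(x,y))$, the function $z_i$ is the height function of a maximal surface with respect to its own coordinates $(x_i,y_i)$. 2. If $n\ge 2$, the decomposition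 in 1 is not unique, even up to reordering, scaling and adding constants to the summands: there are two such decompositions $z=\sum_i z_i=\sum_j z_j'$ on $U'$ for which no $z_i$ is of the form $a z_j'+b$ with $a,b\in\mathbb R$. -/

import Mathlib

open scoped ContDiff

noncomputable section

namespace MaximalSurface

/-- The partial derivative `∂h/∂x` of a function of `(x, y)`. -/
def pdx (h : ℝ × ℝ → ℝ) (q : ℝ × ℝ) : ℝ := fderiv ℝ h q (1, 0)

/-- The partial derivative `∂h/∂y` of a function of `(x, y)`. -/
def pdy (h : ℝ × ℝ → ℝ) (q : ℝ × ℝ) : ℝ := fderiv ℝ h q (0, 1)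

/-- `h` is the height function of a maximal surface in `𝕃³` (metric `dx² + dy² - dz²`) which is a
graph over the open set `W`: the graph is of class `C²`, spacelike, and has zero mean curvature. -/
structure IsMaximalGraph (W : Set (ℝ × ℝ)) (h : ℝ × ℝ → ℝ) : Prop where
  isOpen : IsOpen W
  contDiffOn : ContDiffOn ℝ 2 h W
  spacelike : ∀ q ∈ W, pdx h q ^ 2 + pdy h q ^ 2 < 1
  equation : ∀ q ∈ W,
    (1 - pdx h q ^ 2) * pdy (pdy h) q + 2 * pdx h q * pdy h q * pdy (pdx h) q
      + (1 - pdy h q ^ 2) * pdx (pdx h) q = 0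

/-- The Gauss map of the spacelike graph of `h`, at the point above `q`: the future directed
timelike unit normal `(h_x, h_y, 1) / √(1 - h_x² - h_y²)` for the metric `dx² + dy² - dz²`. -/
def gaussMap (h : ℝ × ℝ → ℝ) (q : ℝ × ℝ) : ℝ × ℝ × ℝ :=
  (√(1 - pdx h q ^ 2 - pdy h q ^ 2))⁻¹ • (pdx h q, pdy h q, (1 : ℝ))

/-- The integral `∫_{ζ₀}^{ζ} F(w) dw` along the straight segment. It is used only for `F`
holomorphic on a convex open set, where the integral does not depend on the path. -/
def segInt (F : ℂ → ℂ) (ζ₀ ζ : ℂ) : ℂ :=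
  (ζ - ζ₀) * ∫ t in (0 : ℝ)..1, F (ζ₀ + (t : ℂ) * (ζ - ζ₀))

/-- First Weierstrass-Enneper coordinate, `x₀ + Re ∫ (1 + w²) M(w) dw`. -/
def weX (M : ℂ → ℂ) (ζ₀ : ℂ) (x₀ : ℝ) (ζ : ℂ) : ℝ :=
  x₀ + (segInt (fun w => (1 + w ^ 2) * M w) ζ₀ ζ).re

/-- Second Weierstrass-Enneper coordinate, `y₀ + Re ∫ i (1 - w²) M(w) dw`. -/
def weY (M : ℂ → ℂ) (ζ₀ : ℂ) (y₀ : ℝ) (ζ : ℂ) : ℝ :=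
  y₀ + (segInt (fun w => Complex.I * (1 - w ^ 2) * M w) ζ₀ ζ).re

/-- Third Weierstrass-Enneper coordinate (the height), `z₀ + Re ∫ -2 w M(w) dw`. -/
def weZ (M : ℂ → ℂ) (ζ₀ : ℂ) (z₀ : ℝ) (ζ : ℂ) : ℝ :=
  z₀ + (segInt (fun w => -2 * w * M w) ζ₀ ζ).re

/-- The graph of `h` over `W` has the Weierstrass-Enneper representation with data `M`, a
holomorphic function without zeros on the convex domain `Ω`, and base values `(x₀, y₀, z₀)`
at `ζ₀ ∈ Ω`. The parameter is `ζ = Φ (x, y)`, where `Φ` is an invertible map from `W` onto `Ω`,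
smooth in both directions. -/
structure IsWERep (Ω : Set ℂ) (ζ₀ : ℂ) (M : ℂ → ℂ) (x₀ y₀ z₀ : ℝ)
    (W : Set (ℝ × ℝ)) (h : ℝ × ℝ → ℝ) (Φ : OpenPartialHomeomorph (ℝ × ℝ) ℂ) : Prop where
  isOpen : IsOpen Ω
  convex : Convex ℝ Ω
  base_mem : ζ₀ ∈ Ω
  holomorphic : DifferentiableOn ℂ M Ω
  ne_zero : ∀ ζ ∈ Ω, M ζ ≠ 0
  source_eq : Φ.source = W
  target_eq : Φ.target = Ω
  smooth : ContDiffOn ℝ ∞ Φ W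
  smooth_symm : ContDiffOn ℝ ∞ Φ.symm Ω
  coord_x : ∀ ζ ∈ Ω, (Φ.symm ζ).1 = weX M ζ₀ x₀ ζ
  coord_y : ∀ ζ ∈ Ω, (Φ.symm ζ).2 = weY M ζ₀ y₀ ζ
  height : ∀ ζ ∈ Ω, h (Φ.symm ζ) = weZ M ζ₀ z₀ ζ

/-- `z = ∑ i, zs i` on `U'` is a decomposition subordinate to the parameter `ζ = Φ (x, y) ∈ Ω` and
the Weierstrass-Enneper data `M` of the graph of `z` over `U'`: the data split as `M = ∑ i, Ms i`
with every `Ms i` holomorphic and without zeros, the functions `(x_i, y_i)` of `ζ ∈ Ω` defined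
by `Ms i` are coordinates on `Ω`, with inverse the map `Φi`, and `zs i`, expressed in the
coordinates `(x_i, y_i)`, is the height function `h` of a maximal surface, whose
Weierstrass-Enneper data are `Ms i`. -/
def IsWEDecomposition (z : ℝ × ℝ → ℝ) (U' : Set (ℝ × ℝ)) (Ω : Set ℂ) (ζ₀ : ℂ) (M : ℂ → ℂ)
    (Φ : OpenPartialHomeomorph (ℝ × ℝ) ℂ) {n : ℕ} (zs : Fin n → ℝ × ℝ → ℝ) : Prop :=
  (∀ q ∈ U', z q = ∑ i, zs i q) ∧
  ∃ Ms : Fin n → ℂ → ℂ, (∀ ζ ∈ Ω, M ζ = ∑ i, Ms i ζ) ∧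
    ∀ i, ∃ (x₀ y₀ z₀ : ℝ) (W : Set (ℝ × ℝ)) (h : ℝ × ℝ → ℝ)
      (Φi : OpenPartialHomeomorph (ℝ × ℝ) ℂ),
      IsMaximalGraph W h ∧ IsWERep Ω ζ₀ (Ms i) x₀ y₀ z₀ W h Φi ∧
      ∀ q ∈ U', zs i q = h (Φi.symm (Φ q))

end MaximalSurface

end

noncomputable section

namespace MaximalSurface

/-! Stereographic projection turns the Gauss map into a parameter w = `gaussParam z` in the unit
disc, and the gradient of z is an explicit function of w alone. Written in w, symmetry of the mixed
derivatives and the maximal surface equation are the real equations making up one Cauchy–Riemann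
equation `GaussCR`. It makes the conformal one-form dG = `weDiffInv w 1` closed. A local primitive G
is an isothermal coordinate in which w is holomorphic; since the Gauss map is injective, so is w,
hence its derivative has no zeros. Taking ζ = w as the parameter gives G = κ(ζ) with κ holomorphic
and M = κ', and the inverse of w has the Weierstrass–Enneper differential `weDiff ζ (M ζ)`
(`exists_local_representation`).

Conversely, such data give a maximal graph wherever the map ζ ↦ (x, y) is injective
(`isMaximalGraph_weZ`). Here x - iy is ∫ M plus the conjugate of ∫ w² M. As |w| < 1, on a small disc
the first term dominates (`weMap_injOn`), and this domination persists when M is multiplied by a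
nonzero complex constant.

The splittings are therefore M = ∑ c_i M with ∑ c_i = 1, whose summands are scaled members of the
associated family, all defined on the same disc. Taking every c_i = 1/n, or every c_i nonreal, gives
two decompositions. An affine relation between summands would force a real ratio of the factors
(`eq_mul_of_weZ_affine`), which is impossible. -/

open Complex Filter Topology

/-! ### Linear algebra of the Weierstrass–Enneper differential. -/

/-- The differential at the parameter `w` of the first two Weierstrass-Enneper coordinates with
density `m`. -/
def weDiff (w m : ℂ) : ℂ →L[ℝ] ℝ × ℝ :=
  (reCLM.comp (((1 + w ^ 2) * m) • (ContinuousLinearMap.id ℝ ℂ))).prod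
    (reCLM.comp ((I * (1 - w ^ 2) * m) • (ContinuousLinearMap.id ℝ ℂ)))

theorem weDiff_apply (w m v : ℂ) :
    weDiff w m v = (((1 + w ^ 2) * m * v).re, (I * (1 - w ^ 2) * m * v).re) := by
  simp only [weDiff, ContinuousLinearMap.prod_apply, ContinuousLinearMap.comp_apply,
    smul_apply, ContinuousLinearMap.id_apply, smul_eq_mul, reCLM_apply]

/-- The inverse of `weDiff w m`. -/
def weDiffInv (w m : ℂ) : ℝ × ℝ →L[ℝ] ℂ :=
  (ContinuousLinearMap.fst ℝ ℝ ℝ).smulRight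
      ((1 - (starRingEnd ℂ w) ^ 2) / (1 - w ^ 2 * (starRingEnd ℂ w) ^ 2) / m) +
    (ContinuousLinearMap.snd ℝ ℝ ℝ).smulRight
      (-I * (1 + (starRingEnd ℂ w) ^ 2) / (1 - w ^ 2 * (starRingEnd ℂ w) ^ 2) / m)

theorem weDiffInv_apply (w m : ℂ) (q : ℝ × ℝ) :
    weDiffInv w m q = q.1 * ((1 - (starRingEnd ℂ w) ^ 2) / (1 - w ^ 2 * (starRingEnd ℂ w) ^ 2) / m)
      + q.2 * (-I * (1 + (starRingEnd ℂ w) ^ 2) / (1 - w ^ 2 * (starRingEnd ℂ w) ^ 2) / m) := by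
  simp [weDiffInv]

theorem one_sub_sq_mul_conj_sq_ne_zero {w : ℂ} (hw : ‖w‖ < 1) :
    1 - w ^ 2 * (starRingEnd ℂ w) ^ 2 ≠ 0 := by
  rw [← mul_pow, mul_conj, normSq_eq_norm_sq]
  norm_cast
  have : (‖w‖ ^ 2) ^ 2 < 1 := by
    have := norm_nonneg w
    exact pow_lt_one₀ (by positivity) (pow_lt_one₀ this hw (by norm_num)) (by norm_num)
  linarith

/-- The two multipliers are chosen so that, once the real parts are expanded, the terms in conj (m
v) cancel. What remains is m v times 1 - |w|⁴, which is nonzero in the disc; this yields the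
inverse. -/
theorem weDiff_combo (w m v : ℂ) :
    (1 - (starRingEnd ℂ w) ^ 2) * ((((1 + w ^ 2) * m * v).re : ℝ) : ℂ)
      - I * (1 + (starRingEnd ℂ w) ^ 2) * (((I * (1 - w ^ 2) * m * v).re : ℝ) : ℂ)
      = (1 - w ^ 2 * (starRingEnd ℂ w) ^ 2) * (m * v) := by
  rw [re_eq_add_conj, re_eq_add_conj]
  simp only [map_mul, map_add, map_sub, map_one, map_pow, conj_I]
  linear_combination (-(1/2) * (1 + (starRingEnd ℂ) w ^ 2) * ((1 - w^2) * m * v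
    - (1 - (starRingEnd ℂ) w ^ 2) * (starRingEnd ℂ) m * (starRingEnd ℂ) v)) * I_sq

theorem weDiffInv_leftInverse {w m : ℂ} (hw : ‖w‖ < 1) (hm : m ≠ 0) :
    Function.LeftInverse (weDiffInv w m) (weDiff w m) := by
  intro v
  have h := one_sub_sq_mul_conj_sq_ne_zero hw
  rw [weDiffInv_apply, weDiff_apply]
  have hc := weDiff_combo w m v
  dsimp only
  generalize ((1 + w ^ 2) * m * v).re = x at *
  generalize (I * (1 - w ^ 2) * m * v).re = y at *
  generalize 1 - w ^ 2 * (starRingEnd ℂ w) ^ 2 = N at *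
  have : (x * ((1 - (starRingEnd ℂ w) ^ 2) / N / m)
      + y * (-I * (1 + (starRingEnd ℂ w) ^ 2) / N / m) : ℂ) = N * (m * v) / N / m := by
    rw [← hc]; ring
  rw [this]
  field_simp

/-- `weDiff w m` as a linear isomorphism. -/
def weEquiv {w m : ℂ} (hw : ‖w‖ < 1) (hm : m ≠ 0) : ℂ ≃L[ℝ] ℝ × ℝ := by
  have h1 := weDiffInv_leftInverse hw hm
  exact (LinearEquiv.ofInjectiveOfFinrankEq (weDiff w m).toLinearMap h1.injective
    (by simp)).toContinuousLinearEquiv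

theorem weEquiv_coe {w m : ℂ} (hw : ‖w‖ < 1) (hm : m ≠ 0) :
    (weEquiv hw hm : ℂ →L[ℝ] ℝ × ℝ) = weDiff w m := by
  ext v <;> rfl

theorem weEquiv_symm_coe {w m : ℂ} (hw : ‖w‖ < 1) (hm : m ≠ 0) :
    ((weEquiv hw hm).symm : ℝ × ℝ →L[ℝ] ℂ) = weDiffInv w m := by
  refine ContinuousLinearMap.ext fun q => ?_
  obtain ⟨v, rfl⟩ := (weEquiv hw hm).surjective q
  have : weEquiv hw hm v = weDiff w m v := congrArg (· v) (weEquiv_coe hw hm)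
  rw [ContinuousLinearEquiv.coe_coe, ContinuousLinearEquiv.symm_apply_apply, this,
    weDiffInv_leftInverse hw hm]

/-! ### The maximal surface equation as a Cauchy–Riemann equation. -/

/-- The slope `h_x` of a spacelike graph in terms of the Gauss parameter. -/
def slopeX (w : ℂ) : ℝ := -2 * w.re / (1 + (w.re ^ 2 + w.im ^ 2))

/-- The slope `h_y` of a spacelike graph in terms of the Gauss parameter. -/
def slopeY (w : ℂ) : ℝ := -2 * w.im / (1 + (w.re ^ 2 + w.im ^ 2))

theorem slope_spacelike {w : ℂ} (hw : ‖w‖ < 1) : slopeX w ^ 2 + slopeY w ^ 2 < 1 := by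
  have h : w.re ^ 2 + w.im ^ 2 < 1 := by
    have := normSq_eq_norm_sq w
    rw [normSq_apply] at this
    nlinarith [norm_nonneg w]
  have h' : 0 ≤ w.re ^ 2 + w.im ^ 2 := by positivity
  rw [slopeX, slopeY, div_pow, div_pow, ← add_div, div_lt_one (by positivity)]
  nlinarith

/-- This is dz = z_x dx + z_y dy in the parameter. The slopes do not involve m, so the tangent plane
at ζ is the same for all data. -/
theorem height_diff (w m v : ℂ) :
    slopeX w * (weDiff w m v).1 + slopeY w * (weDiff w m v).2 = (-2 * w * m * v).re := by
  rw [weDiff_apply, slopeX, slopeY, mul_assoc _ m v, mul_assoc _ m v, mul_assoc _ m v]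
  generalize m * v = y
  have h : 1 + (w.re ^ 2 + w.im ^ 2) ≠ 0 := by positivity
  simp [pow_two] at h ⊢
  field_simp
  ring

theorem fderiv_slopeX {w : ℝ × ℝ → ℂ} {L : ℝ × ℝ →L[ℝ] ℂ} {q : ℝ × ℝ}
    (hw : HasFDerivAt w L q) (v : ℝ × ℝ) :
    fderiv ℝ (fun q => slopeX (w q)) q v =
      -2 * ((1 + (w q).im ^ 2 - (w q).re ^ 2) * (L v).re - 2 * (w q).re * (w q).im * (L v).im)
        / (1 + ((w q).re ^ 2 + (w q).im ^ 2)) ^ 2 := by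
  have h : 1 + ((w q).re ^ 2 + (w q).im ^ 2) ≠ 0 := by positivity
  have hre : HasFDerivAt (fun q => (w q).re) (reCLM.comp L) q :=
    reCLM.hasFDerivAt.comp q hw
  have him : HasFDerivAt (fun q => (w q).im) (imCLM.comp L) q :=
    imCLM.hasFDerivAt.comp q hw
  simp only [slopeX, div_eq_mul_inv, pow_two] at h ⊢
  have hN : HasFDerivAt (fun q => 1 + ((w q).re * (w q).re + (w q).im * (w q).im)) _ q :=
    ((hre.mul hre).add (him.mul him)).const_add 1
  have := (hre.const_mul (-2)).fun_mul
    (HasDerivAt.comp_hasFDerivAt (h₂ := fun y => y⁻¹) q (hasDerivAt_inv h) hN)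
  refine (DFunLike.congr_fun this.fderiv v).trans ?_
  simp
  field_simp
  ring

theorem fderiv_slopeY {w : ℝ × ℝ → ℂ} {L : ℝ × ℝ →L[ℝ] ℂ} {q : ℝ × ℝ}
    (hw : HasFDerivAt w L q) (v : ℝ × ℝ) :
    fderiv ℝ (fun q => slopeY (w q)) q v =
      -2 * ((1 + (w q).re ^ 2 - (w q).im ^ 2) * (L v).im - 2 * (w q).re * (w q).im * (L v).re)
        / (1 + ((w q).re ^ 2 + (w q).im ^ 2)) ^ 2 := by
  have h : 1 + ((w q).re ^ 2 + (w q).im ^ 2) ≠ 0 := by positivity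
  have hre : HasFDerivAt (fun q => (w q).re) (reCLM.comp L) q :=
    reCLM.hasFDerivAt.comp q hw
  have him : HasFDerivAt (fun q => (w q).im) (imCLM.comp L) q :=
    imCLM.hasFDerivAt.comp q hw
  simp only [slopeY, div_eq_mul_inv, pow_two] at h ⊢
  have hN : HasFDerivAt (fun q => 1 + ((w q).re * (w q).re + (w q).im * (w q).im)) _ q :=
    ((hre.mul hre).add (him.mul him)).const_add 1
  have := (him.const_mul (-2)).fun_mul
    (HasDerivAt.comp_hasFDerivAt (h₂ := fun y => y⁻¹) q (hasDerivAt_inv h) hN)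
  refine (DFunLike.congr_fun this.fderiv v).trans ?_
  simp
  field_simp
  ring

/-- The Cauchy-Riemann equation for the Gauss parameter, with respect to the conformal structure
of the surface. -/
def GaussCR (w wx wy : ℂ) : Prop :=
  (1 - (starRingEnd ℂ w) ^ 2) * wy + I * (1 + (starRingEnd ℂ w) ^ 2) * wx = 0

/-- The real part encodes equality of the mixed derivatives of h; the imaginary part is what the
maximal surface equation adds. -/
theorem gaussCR_iff (w wx wy : ℂ) : GaussCR w wx wy ↔
    (1 + w.im ^ 2 - w.re ^ 2) * wy.re - 2 * w.re * w.im * wy.im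
        = (1 + w.re ^ 2 - w.im ^ 2) * wx.im - 2 * w.re * w.im * wx.re ∧
    (1 + w.im ^ 2 - w.re ^ 2) * wy.im + 2 * w.re * w.im * wy.re
        + (1 + w.re ^ 2 - w.im ^ 2) * wx.re + 2 * w.re * w.im * wx.im = 0 := by
  rw [GaussCR, Complex.ext_iff]
  simp [pow_two]
  constructor
  · rintro ⟨h1, h2⟩
    constructor <;> linarith
  · rintro ⟨h1, h2⟩
    constructor <;> linarith

section SecondDerivatives

variable {h : ℝ × ℝ → ℝ} {w : ℝ × ℝ → ℂ} {L : ℝ × ℝ →L[ℝ] ℂ} {q : ℝ × ℝ}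
  (hx : pdx h =ᶠ[𝓝 q] fun q => slopeX (w q)) (hy : pdy h =ᶠ[𝓝 q] fun q => slopeY (w q))
  (hw : HasFDerivAt w L q)

include hx hy hw

/-- The mean curvature expression is a combination of the two real equations in `gaussCR_iff`, the
second with weight 1 - |w|⁴ ≠ 0 in the disc. Hence one identity serves both directions. -/
theorem equation_eq :
    (1 - pdx h q ^ 2) * pdy (pdy h) q + 2 * pdx h q * pdy h q * pdy (pdx h) q
      + (1 - pdy h q ^ 2) * pdx (pdx h) q =
    -2 / (1 + ((w q).re ^ 2 + (w q).im ^ 2)) ^ 4 *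
     (4 * (w q).re * (w q).im *
      (((1 + (w q).im ^ 2 - (w q).re ^ 2) * (L (0, 1)).re - 2 * (w q).re * (w q).im * (L (0, 1)).im)
      - ((1 + (w q).re ^ 2 - (w q).im ^ 2) * (L (1, 0)).im
        - 2 * (w q).re * (w q).im * (L (1, 0)).re))
      + (1 - ((w q).re ^ 2 + (w q).im ^ 2) ^ 2) *
       ((1 + (w q).im ^ 2 - (w q).re ^ 2) * (L (0, 1)).im + 2 * (w q).re * (w q).im * (L (0, 1)).re
        + (1 + (w q).re ^ 2 - (w q).im ^ 2) * (L (1, 0)).re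
        + 2 * (w q).re * (w q).im * (L (1, 0)).im)) := by
  have hxx := fun v => (DFunLike.congr_fun hx.fderiv_eq v).trans (fderiv_slopeX hw v)
  have hyy := fun v => (DFunLike.congr_fun hy.fderiv_eq v).trans (fderiv_slopeY hw v)
  have e1 : pdx (pdx h) q = _ := hxx (1, 0)
  have e2 : pdy (pdx h) q = _ := hxx (0, 1)
  have e3 : pdy (pdy h) q = _ := hyy (0, 1)
  rw [e1, e2, e3, hx.eq_of_nhds, hy.eq_of_nhds]
  simp only [slopeX, slopeY]
  have h0 : 1 + ((w q).re ^ 2 + (w q).im ^ 2) ≠ 0 := by positivity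
  field_simp
  ring

/-- The maximal surface equation, together with the symmetry of the second derivatives, implies
that the Gauss parameter is holomorphic. -/
theorem gaussCR_of_equation (hq : ‖w q‖ < 1) (hsymm : pdx (pdy h) q = pdy (pdx h) q)
    (heq : (1 - pdx h q ^ 2) * pdy (pdy h) q + 2 * pdx h q * pdy h q * pdy (pdx h) q
      + (1 - pdy h q ^ 2) * pdx (pdx h) q = 0) : GaussCR (w q) (L (1, 0)) (L (0, 1)) := by
  have hxx := fun v => (DFunLike.congr_fun hx.fderiv_eq v).trans (fderiv_slopeX hw v)
  have hyy := fun v => (DFunLike.congr_fun hy.fderiv_eq v).trans (fderiv_slopeY hw v)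
  have e1 : pdx (pdy h) q = _ := hyy (1, 0)
  have e2 : pdy (pdx h) q = _ := hxx (0, 1)
  rw [e1, e2] at hsymm
  have h0 : 1 + ((w q).re ^ 2 + (w q).im ^ 2) ≠ 0 := by positivity
  have hlt : (w q).re ^ 2 + (w q).im ^ 2 < 1 := by
    have := normSq_eq_norm_sq (w q)
    rw [normSq_apply] at this
    nlinarith [norm_nonneg (w q)]
  have hR := mul_left_cancel₀ (by norm_num : (-2 : ℝ) ≠ 0)
    ((div_left_inj' (pow_ne_zero 2 h0)).1 hsymm)
  rw [equation_eq hx hy hw, hR, sub_self, mul_zero, zero_add] at heq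
  rw [gaussCR_iff]
  refine ⟨hR.symm, ?_⟩
  have h1 : 1 - ((w q).re ^ 2 + (w q).im ^ 2) ^ 2 ≠ 0 := by
    have : 0 ≤ (w q).re ^ 2 + (w q).im ^ 2 := by positivity
    nlinarith
  have h2 : -2 / (1 + ((w q).re ^ 2 + (w q).im ^ 2)) ^ 4 ≠ 0 :=
    div_ne_zero (by norm_num) (pow_ne_zero 4 h0)
  exact (mul_eq_zero.1 ((mul_eq_zero.1 heq).resolve_left h2)).resolve_left h1

theorem equation_of_gaussCR (hcr : GaussCR (w q) (L (1, 0)) (L (0, 1))) :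
    (1 - pdx h q ^ 2) * pdy (pdy h) q + 2 * pdx h q * pdy h q * pdy (pdx h) q
      + (1 - pdy h q ^ 2) * pdx (pdx h) q = 0 := by
  rw [gaussCR_iff] at hcr
  rw [equation_eq hx hy hw, hcr.1, hcr.2]
  ring

end SecondDerivatives

/-- The density m only divides both partial derivatives, so any chart with this differential
satisfies the equation, whatever the data. -/
theorem gaussCR_weDiffInv (w m : ℂ) :
    GaussCR w (weDiffInv w m (1, 0)) (weDiffInv w m (0, 1)) := by
  rw [GaussCR, weDiffInv_apply, weDiffInv_apply]
  simp
  ring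

/-! ### From Weierstrass–Enneper data to a maximal graph. -/

/-- On a convex domain F has a primitive, and the segment integral is its increment. -/
theorem hasDerivAt_segInt {Ω : Set ℂ} (ho : IsOpen Ω) (hc : Convex ℝ Ω) {F : ℂ → ℂ}
    (hF : DifferentiableOn ℂ F Ω) {ζ₀ ζ : ℂ} (h₀ : ζ₀ ∈ Ω) (hζ : ζ ∈ Ω) :
    HasDerivAt (segInt F ζ₀) (F ζ) ζ := by
  obtain ⟨g, hg⟩ := hc.exists_forall_hasDerivWithinAt hF
  have hg' : ∀ a ∈ Ω, HasDerivAt g (F a) a := fun a ha => (hg a ha).hasDerivAt (ho.mem_nhds ha)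
  have key : ∀ a ∈ Ω, segInt F ζ₀ a = g a - g ζ₀ := by
    intro a ha
    have hmem : ∀ t ∈ Set.uIcc (0 : ℝ) 1, ζ₀ + (t : ℂ) * (a - ζ₀) ∈ Ω := by
      intro t ht
      rw [Set.uIcc_of_le zero_le_one] at ht
      have := hc.add_smul_sub_mem h₀ ha ht
      simpa using this
    have hline : ∀ t : ℝ, HasDerivAt (fun t : ℝ => ζ₀ + (t : ℂ) * (a - ζ₀)) (a - ζ₀) t := by
      intro t
      simpa using ((Complex.ofRealCLM.hasDerivAt (x := t)).mul_const (a - ζ₀)).const_add ζ₀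
    have hd : ∀ t ∈ Set.uIcc (0 : ℝ) 1, HasDerivAt (fun t : ℝ => g (ζ₀ + (t : ℂ) * (a - ζ₀)))
        (F (ζ₀ + (t : ℂ) * (a - ζ₀)) * (a - ζ₀)) t := fun t ht =>
      (hg' _ (hmem t ht)).comp (h := fun t : ℝ => ζ₀ + (t : ℂ) * (a - ζ₀)) t (hline t)
    have hcont : ContinuousOn (fun t : ℝ => F (ζ₀ + (t : ℂ) * (a - ζ₀)) * (a - ζ₀))
        (Set.uIcc 0 1) :=
      (hF.continuousOn.comp (fun t _ => (hline t).continuousAt.continuousWithinAt) hmem).mul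
        continuousOn_const
    have := intervalIntegral.integral_eq_sub_of_hasDerivAt hd hcont.intervalIntegrable
    rw [intervalIntegral.integral_mul_const] at this
    rw [segInt, mul_comm, this]
    simp
  refine ((hg' ζ hζ).sub_const (g ζ₀)).congr_of_eventuallyEq ?_
  filter_upwards [ho.mem_nhds hζ] with a ha using key a ha

theorem segInt_self (F : ℂ → ℂ) (ζ₀ : ℂ) : segInt F ζ₀ ζ₀ = 0 := by simp [segInt]

theorem segInt_const_mul (c : ℂ) (F : ℂ → ℂ) (ζ₀ ζ : ℂ) :
    segInt (fun w => c * F w) ζ₀ ζ = c * segInt F ζ₀ ζ := by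
  rw [segInt, segInt, intervalIntegral.integral_const_mul]
  ring

/-- The map `ζ ↦ (x, y)` given by the first two Weierstrass-Enneper coordinates. -/
def weMap (M : ℂ → ℂ) (ζ₀ : ℂ) (x₀ y₀ : ℝ) (ζ : ℂ) : ℝ × ℝ := (weX M ζ₀ x₀ ζ, weY M ζ₀ y₀ ζ)

section Coordinates

variable {Ω : Set ℂ} {M : ℂ → ℂ} {ζ₀ : ℂ}

theorem weMap_self (x₀ y₀ : ℝ) : weMap M ζ₀ x₀ y₀ ζ₀ = (x₀, y₀) := by
  simp [weMap, weX, weY, segInt_self]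

theorem weZ_self (z₀ : ℝ) : weZ M ζ₀ z₀ ζ₀ = z₀ := by simp [weZ, segInt_self]

theorem weZ_const_mul (c : ℂ) (z₀ : ℝ) (ζ : ℂ) :
    weZ (fun w => c * M w) ζ₀ z₀ ζ
      = z₀ + (c * segInt (fun w => -2 * w * M w) ζ₀ ζ).re := by
  rw [weZ, ← segInt_const_mul]
  simp only [mul_left_comm]

variable (ho : IsOpen Ω) (hc : Convex ℝ Ω) (h₀ : ζ₀ ∈ Ω) (hM : DifferentiableOn ℂ M Ω)

include ho hc h₀ hM

theorem hasFDerivAt_re_segInt {k : ℂ → ℂ} (hk : Differentiable ℂ k) (a : ℝ) {ζ : ℂ}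
    (hζ : ζ ∈ Ω) :
    HasFDerivAt (fun ζ => a + (segInt (fun w => k w * M w) ζ₀ ζ).re)
      (reCLM.comp ((k ζ * M ζ) • ContinuousLinearMap.id ℝ ℂ)) ζ := by
  have h := (hasDerivAt_segInt ho hc (hk.differentiableOn.mul hM) h₀ hζ).complexToReal_fderiv
  have h2 := (reCLM.hasFDerivAt.comp ζ h).const_add a
  refine h2.congr_fderiv ?_
  ext v
  simp

theorem contDiffOn_re_segInt {k : ℂ → ℂ} (hk : Differentiable ℂ k) (a : ℝ) :
    ContDiffOn ℝ ∞ (fun ζ => a + (segInt (fun w => k w * M w) ζ₀ ζ).re) Ω := by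
  have h : DifferentiableOn ℂ (segInt (fun w => k w * M w) ζ₀) Ω := fun ζ hζ =>
    (hasDerivAt_segInt ho hc (hk.differentiableOn.mul hM) h₀ hζ).differentiableAt
      |>.differentiableWithinAt
  have h2 : ContDiffOn ℝ ∞ (segInt (fun w => k w * M w) ζ₀) Ω :=
    (h.contDiffOn (n := ∞) ho).restrict_scalars ℝ
  exact contDiffOn_const.add (reCLM.contDiff.comp_contDiffOn h2)

theorem hasFDerivAt_weMap (x₀ y₀ : ℝ) {ζ : ℂ} (hζ : ζ ∈ Ω) :
    HasFDerivAt (weMap M ζ₀ x₀ y₀) (weDiff ζ (M ζ)) ζ :=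
  (hasFDerivAt_re_segInt ho hc h₀ hM (k := fun w => 1 + w ^ 2) (by fun_prop) x₀ hζ).prodMk
    (hasFDerivAt_re_segInt ho hc h₀ hM (k := fun w => I * (1 - w ^ 2)) (by fun_prop) y₀ hζ)

theorem hasFDerivAt_weZ (z₀ : ℝ) {ζ : ℂ} (hζ : ζ ∈ Ω) :
    HasFDerivAt (weZ M ζ₀ z₀) (reCLM.comp ((-2 * ζ * M ζ) • ContinuousLinearMap.id ℝ ℂ)) ζ :=
  hasFDerivAt_re_segInt ho hc h₀ hM (k := fun w => -2 * w) (by fun_prop) z₀ hζ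

theorem contDiffOn_weMap (x₀ y₀ : ℝ) : ContDiffOn ℝ ∞ (weMap M ζ₀ x₀ y₀) Ω :=
  (contDiffOn_re_segInt ho hc h₀ hM (k := fun w => 1 + w ^ 2) (by fun_prop) x₀).prodMk
    (contDiffOn_re_segInt ho hc h₀ hM (k := fun w => I * (1 - w ^ 2)) (by fun_prop) y₀)

theorem contDiffOn_weZ (z₀ : ℝ) : ContDiffOn ℝ ∞ (weZ M ζ₀ z₀) Ω :=
  contDiffOn_re_segInt ho hc h₀ hM (k := fun w => -2 * w) (by fun_prop) z₀

/-- If `M` is close to a constant `u` and `w² M` is small, then the first two Weierstrass-Enneper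
coordinates are injective: `x + i y` is the sum of `conj ∫ M` and of the smaller `∫ w² M`. -/
theorem weMap_injOn (x₀ y₀ : ℝ) {u : ℂ} {κ₁ κ₂ : ℝ} (h1 : ∀ ζ ∈ Ω, ‖M ζ - u‖ ≤ κ₁)
    (h2 : ∀ ζ ∈ Ω, ‖ζ ^ 2 * M ζ‖ ≤ κ₂) (hκ : κ₁ + κ₂ < ‖u‖) :
    Set.InjOn (weMap M ζ₀ x₀ y₀) Ω := by
  -- T is (x, y) ↦ x - iy. The mean value inequality is applied to T ∘ `weMap` minus multiplication
  -- by u: a Lipschitz constant below ‖u‖ excludes coinciding values.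
  let T : ℝ × ℝ →L[ℝ] ℂ := (ContinuousLinearMap.fst ℝ ℝ ℝ).smulRight (1 : ℂ) +
    (ContinuousLinearMap.snd ℝ ℝ ℝ).smulRight (-I)
  let S : ℂ →L[ℝ] ℂ := u • ContinuousLinearMap.id ℝ ℂ
  have hT : ∀ w m v : ℂ, T (weDiff w m v) = m * v + (starRingEnd ℂ) (w ^ 2 * m * v) := by
    intro w m v
    rw [weDiff_apply]
    apply Complex.ext
    · simp [T, pow_two]; ring
    · simp [T, pow_two]; ring
  have hd : ∀ ζ ∈ Ω, HasFDerivWithinAt (fun ζ => T (weMap M ζ₀ x₀ y₀ ζ) - S ζ)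
      (T.comp (weDiff ζ (M ζ)) - S) Ω ζ := fun ζ hζ =>
    ((T.hasFDerivAt.comp ζ (hasFDerivAt_weMap ho hc h₀ hM x₀ y₀ hζ)).sub
      S.hasFDerivAt).hasFDerivWithinAt
  have hbd : ∀ ζ ∈ Ω, ‖T.comp (weDiff ζ (M ζ)) - S‖ ≤ κ₁ + κ₂ := by
    intro ζ hζ
    refine ContinuousLinearMap.opNorm_le_bound _
      (add_nonneg ((norm_nonneg _).trans (h1 ζ hζ)) ((norm_nonneg _).trans (h2 ζ hζ))) fun v => ?_
    have : (T.comp (weDiff ζ (M ζ)) - S) v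
        = (M ζ - u) * v + (starRingEnd ℂ) (ζ ^ 2 * M ζ * v) := by
      simp only [sub_apply, ContinuousLinearMap.comp_apply, hT]
      simp only [S, smul_apply, ContinuousLinearMap.id_apply, smul_eq_mul]
      ring
    rw [this, add_mul]
    refine (norm_add_le _ _).trans (add_le_add ?_ ?_)
    · rw [norm_mul]; exact mul_le_mul_of_nonneg_right (h1 ζ hζ) (norm_nonneg _)
    · rw [RCLike.norm_conj, norm_mul]; exact mul_le_mul_of_nonneg_right (h2 ζ hζ) (norm_nonneg _)
  intro a ha b hb hab
  have := hc.norm_image_sub_le_of_norm_hasFDerivWithin_le hd hbd ha hb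
  by_contra hne
  have hpos : 0 < ‖b - a‖ := norm_pos_iff.2 (sub_ne_zero.2 (Ne.symm hne))
  have e : T (weMap M ζ₀ x₀ y₀ b) - S b - (T (weMap M ζ₀ x₀ y₀ a) - S a) = -(u * (b - a)) := by
    rw [hab]
    simp only [S, smul_apply, ContinuousLinearMap.id_apply, smul_eq_mul]
    ring
  rw [e, norm_neg, norm_mul] at this
  exact absurd (le_of_mul_le_mul_right this hpos) (not_le.2 hκ)

/-- The first two Weierstrass-Enneper coordinates as a chart. -/
theorem exists_chart_weMap (x₀ y₀ : ℝ) (hw : ∀ ζ ∈ Ω, ‖ζ‖ < 1) (hne : ∀ ζ ∈ Ω, M ζ ≠ 0)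
    (hinj : Set.InjOn (weMap M ζ₀ x₀ y₀) Ω) :
    ∃ Φ : OpenPartialHomeomorph (ℝ × ℝ) ℂ, Φ.target = Ω ∧ (Φ.symm : ℂ → ℝ × ℝ) = weMap M ζ₀ x₀ y₀ ∧
      (∀ q ∈ Φ.source, HasFDerivAt Φ (weDiffInv (Φ q) (M (Φ q))) q) ∧
      ContDiffOn ℝ ∞ Φ Φ.source := by
  let f := weMap M ζ₀ x₀ y₀
  have hcd : ∀ ζ ∈ Ω, ContDiffAt ℝ ∞ f ζ := fun ζ hζ =>
    (contDiffOn_weMap ho hc h₀ hM x₀ y₀).contDiffAt (ho.mem_nhds hζ)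
  have hfd : ∀ ζ (hζ : ζ ∈ Ω), HasFDerivAt f (weEquiv (hw ζ hζ) (hne ζ hζ) : ℂ →L[ℝ] ℝ × ℝ) ζ := by
    intro ζ hζ
    rw [weEquiv_coe]
    exact hasFDerivAt_weMap ho hc h₀ hM x₀ y₀ hζ
  have hopen : IsOpenMap (Ω.domRestrict f) := by
    rw [isOpenMap_iff_nhds_le]
    rintro ⟨ζ, hζ⟩
    have hs := (hcd ζ hζ).hasStrictFDerivAt' (hfd ζ hζ) (by simp)
    have := hs.map_nhds_eq_of_equiv
    rw [Set.domRestrict_apply, ← this, Set.domRestrict_eq, ← Filter.map_map,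
      map_nhds_subtype_coe_eq_nhds hζ (ho.mem_nhds hζ)]
  let e : OpenPartialHomeomorph ℂ (ℝ × ℝ) := OpenPartialHomeomorph.ofContinuousOpenRestrict
    (hinj.toPartialEquiv f Ω) (contDiffOn_weMap ho hc h₀ hM x₀ y₀).continuousOn hopen ho
  have hes : e.source = Ω := rfl
  have hef : (e : ℂ → ℝ × ℝ) = f := rfl
  have hmem : ∀ q ∈ e.target, e.symm q ∈ Ω := fun q hq => e.map_target hq
  refine ⟨e.symm, rfl, rfl, fun q hq => ?_, fun q hq => ?_⟩
  · have := e.hasFDerivAt_symm hq (hfd _ (hmem q hq))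
    rwa [weEquiv_symm_coe] at this
  · exact (e.contDiffAt_symm hq (hfd _ (hmem q hq)) (hcd _ (hmem q hq))).contDiffWithinAt

/-- The surface with given Weierstrass-Enneper data is a maximal graph. -/
theorem isMaximalGraph_weZ (z₀ : ℝ) (hw : ∀ ζ ∈ Ω, ‖ζ‖ < 1) (hne : ∀ ζ ∈ Ω, M ζ ≠ 0)
    {Φ : OpenPartialHomeomorph (ℝ × ℝ) ℂ} (ht : Φ.target = Ω)
    (hΦ : ∀ q ∈ Φ.source, HasFDerivAt Φ (weDiffInv (Φ q) (M (Φ q))) q)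
    (hsm : ContDiffOn ℝ ∞ Φ Φ.source) :
    IsMaximalGraph Φ.source (fun q => weZ M ζ₀ z₀ (Φ q)) := by
  have hmem : ∀ q ∈ Φ.source, Φ q ∈ Ω := fun q hq => ht ▸ Φ.map_source hq
  have hd : ∀ q ∈ Φ.source, ∀ v : ℝ × ℝ, fderiv ℝ (fun q => weZ M ζ₀ z₀ (Φ q)) q v
      = slopeX (Φ q) * v.1 + slopeY (Φ q) * v.2 := by
    intro q hq v
    have h := (hasFDerivAt_weZ ho hc h₀ hM z₀ (hmem q hq)).comp q (hΦ q hq)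
    refine (DFunLike.congr_fun h.fderiv v).trans ?_
    -- Testing on vectors in the image of `weDiff` reduces the gradient to `height_diff`.
    obtain ⟨y, rfl⟩ := (weEquiv (hw _ (hmem q hq)) (hne _ (hmem q hq))).surjective v
    rw [show weEquiv (hw _ (hmem q hq)) (hne _ (hmem q hq)) y = weDiff _ _ y from
      DFunLike.congr_fun (weEquiv_coe (hw _ (hmem q hq)) (hne _ (hmem q hq))) y, height_diff, ContinuousLinearMap.comp_apply,
      weDiffInv_leftInverse (hw _ (hmem q hq)) (hne _ (hmem q hq))]
    simp [ContinuousLinearMap.comp_apply]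
  have hx : ∀ q ∈ Φ.source, pdx (fun q => weZ M ζ₀ z₀ (Φ q)) q = slopeX (Φ q) := fun q hq => by
    rw [pdx, hd q hq]; simp
  have hy : ∀ q ∈ Φ.source, pdy (fun q => weZ M ζ₀ z₀ (Φ q)) q = slopeY (Φ q) := fun q hq => by
    rw [pdy, hd q hq]; simp
  refine ⟨Φ.open_source, ?_, fun q hq => ?_, fun q hq => ?_⟩
  · exact ((contDiffOn_weZ ho hc h₀ hM z₀).comp hsm hmem).of_le (WithTop.coe_le_coe.2 (le_top : (2 : ℕ∞) ≤ ⊤))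
  · rw [hx q hq, hy q hq]; exact slope_spacelike (hw _ (hmem q hq))
  · have hn := Φ.open_source.mem_nhds hq
    refine equation_of_gaussCR (w := Φ) (L := weDiffInv (Φ q) (M (Φ q))) ?_ ?_ (hΦ q hq)
      (gaussCR_weDiffInv _ _)
    · filter_upwards [hn] with a ha using hx a ha
    · filter_upwards [hn] with a ha using hy a ha

end Coordinates

/-! ### Injective holomorphic functions have nonvanishing derivative. -/

/-- The derivative of an injective holomorphic function has no zeros. -/
theorem deriv_ne_zero_of_injOn {f : ℂ → ℂ} {s : Set ℂ} (hs : IsOpen s)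
    (hf : DifferentiableOn ℂ f s) (hinj : Set.InjOn f s) {a : ℂ} (ha : a ∈ s) :
    deriv f a ≠ 0 := by
  have hfa : AnalyticAt ℂ f a := hf.analyticAt (hs.mem_nhds ha)
  have hga : AnalyticAt ℂ (fun z => f z - f a) a := hfa.sub analyticAt_const
  have hnt : ¬ ∀ᶠ z in 𝓝 a, f z - f a = 0 := by
    intro h
    have h1 : ∀ᶠ z in 𝓝 a, z = a := by
      filter_upwards [h, hs.mem_nhds ha] with z hz hzs using hinj hzs ha (sub_eq_zero.1 hz)
    have h2 : ∀ᶠ z in 𝓝[≠] a, False := by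
      filter_upwards [h1.filter_mono nhdsWithin_le_nhds, self_mem_nhdsWithin] with z hz hz'
      exact hz' hz
    exact h2.exists.elim fun _ => id
  obtain ⟨n, φ, hφ, hφa, hev⟩ := hga.exists_eventuallyEq_pow_smul_nonzero_iff.2 hnt
  simp only [smul_eq_mul] at hev
  have hn0 : n ≠ 0 := by
    rintro rfl
    have := hev.self_of_nhds
    simp at this
    exact hφa this.symm
  by_cases hn1 : n = 1
  · subst hn1
    have h1 : HasDerivAt (fun z => (z - a) ^ 1 * φ z) (φ a) a := by
      have := (((hasDerivAt_id a).sub_const a).mul hφ.differentiableAt.hasDerivAt)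
      simpa [Pi.mul_def] using this
    have h2 : HasDerivAt f (φ a) a := by
      have := (h1.congr_of_eventuallyEq hev).add_const (f a)
      simpa using this
    rwa [h2.deriv]
  · exfalso
    -- An n-th root of (f - f a) / φ a near a, by the principal logarithm of φ / φ a, which is close
    -- to 1. It is a local coordinate, and f - f a = φ a · hⁿ.
    let h : ℂ → ℂ := fun z => (z - a) * Complex.exp (Complex.log (φ z / φ a) / n)
    have hq : AnalyticAt ℂ (fun z => Complex.exp (Complex.log (φ z / φ a) / n)) a := by
      refine AnalyticAt.cexp ?_
      refine AnalyticAt.div (AnalyticAt.clog (hφ.div analyticAt_const hφa) ?_) analyticAt_const ?_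
      · simp [div_self hφa]
      · exact_mod_cast hn0
    have hh : AnalyticAt ℂ h a := (analyticAt_id.sub analyticAt_const).mul hq
    have hd : HasDerivAt h 1 a := by
      have := ((hasDerivAt_id a).sub_const a).mul hq.differentiableAt.hasDerivAt
      simpa [Pi.mul_def, hφa] using this
    have hmap : map h (𝓝 a) = 𝓝 0 := by
      have hs := hh.hasStrictDerivAt
      rw [hd.deriv] at hs
      simpa [h] using hs.map_nhds_eq one_ne_zero
    have hpow : ∀ᶠ z in 𝓝 a, z ∈ s ∧ f z - f a = φ a * h z ^ n := by
      filter_upwards [hs.mem_nhds ha, hev, hφ.continuousAt.eventually_ne hφa] with z hz h1 h2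
      refine ⟨hz, ?_⟩
      have hn : (n : ℂ) ≠ 0 := by exact_mod_cast hn0
      rw [h1, mul_pow, ← Complex.exp_nat_mul, mul_div_cancel₀ _ hn,
        Complex.exp_log (div_ne_zero h2 hφa)]
      field_simp
    have him : ∀ᶠ t in 𝓝 (0 : ℂ), ∃ z, (z ∈ s ∧ f z - f a = φ a * h z ^ n) ∧ h z = t := by
      rw [← hmap]
      exact image_mem_map hpow
    -- For n ≥ 2, h takes both values t and r t for some small t ≠ 0, where r ≠ 1 and rⁿ = 1; f
    -- agrees at the two points, against injectivity.
    have hr := Complex.isPrimitiveRoot_exp n hn0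
    set r := Complex.exp (2 * Real.pi * I / n)
    have hr1 : r ≠ 1 := hr.ne_one (by omega)
    have him2 : ∀ᶠ t in 𝓝 (0 : ℂ), ∃ z, (z ∈ s ∧ f z - f a = φ a * h z ^ n) ∧ h z = r * t := by
      have : Tendsto (fun t : ℂ => r * t) (𝓝 0) (𝓝 0) := by
        simpa using (continuous_const_mul r).tendsto 0
      exact this.eventually him
    obtain ⟨t, ⟨⟨z₁, ⟨hz₁, e₁⟩, ht₁⟩, z₂, ⟨hz₂, e₂⟩, ht₂⟩, ht⟩ :=
      (((him.and him2).filter_mono (nhdsWithin_le_nhds (s := {0}ᶜ))).and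
        self_mem_nhdsWithin).exists
    have : z₁ = z₂ := by
      refine hinj hz₁ hz₂ ?_
      have : f z₁ - f a = f z₂ - f a := by
        rw [e₁, e₂, ht₁, ht₂, mul_pow, hr.pow_eq_one, one_mul]
      linear_combination this
    subst this
    rw [ht₁] at ht₂
    have h3 : (r - 1) * t = 0 := by linear_combination -ht₂
    exact (mul_ne_zero (sub_ne_zero.2 hr1) ht) h3

/-! ### The Gauss parameter of a maximal graph. -/

/-- The stereographic projection of the Gauss map of a spacelike graph. -/
def gaussParam (h : ℝ × ℝ → ℝ) (q : ℝ × ℝ) : ℂ :=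
  -(((1 + √(1 - pdx h q ^ 2 - pdy h q ^ 2))⁻¹ : ℝ) • (⟨pdx h q, pdy h q⟩ : ℂ))

section GaussParam

variable {U : Set (ℝ × ℝ)} {z : ℝ × ℝ → ℝ} (hz : IsMaximalGraph U z)

include hz

/-- With s = √(1 - z_x² - z_y²) > 0, one gets |w|² = (1 - s)/(1 + s) < 1 and 1 + |w|² = 2/(1 + s),
which recovers the gradient from w. -/
theorem gaussParam_spec {q : ℝ × ℝ} (hq : q ∈ U) : ‖gaussParam z q‖ < 1 ∧
    pdx z q = slopeX (gaussParam z q) ∧ pdy z q = slopeY (gaussParam z q) := by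
  have hs := hz.spacelike q hq
  have hpos : 0 < 1 - pdx z q ^ 2 - pdy z q ^ 2 := by linarith
  have hsq := Real.sq_sqrt hpos.le
  have hsp := Real.sqrt_pos.2 hpos
  have hre : (gaussParam z q).re = -((1 + √(1 - pdx z q ^ 2 - pdy z q ^ 2))⁻¹ * pdx z q) := by
    rw [gaussParam, neg_re, smul_re, smul_eq_mul]
  have him : (gaussParam z q).im = -((1 + √(1 - pdx z q ^ 2 - pdy z q ^ 2))⁻¹ * pdy z q) := by
    rw [gaussParam, neg_im, smul_im, smul_eq_mul]
  generalize √(1 - pdx z q ^ 2 - pdy z q ^ 2) = s at *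
  generalize pdx z q = a at *
  generalize pdy z q = b at *
  have h1 : 1 + s ≠ 0 := by positivity
  have hN : (gaussParam z q).re ^ 2 + (gaussParam z q).im ^ 2 = (1 - s) / (1 + s) := by
    rw [hre, him]
    field_simp
    linear_combination hsq
  have hD : 1 + (1 - s) / (1 + s) = 2 / (1 + s) := by field_simp; ring
  refine ⟨?_, ?_, ?_⟩
  · have h2 := normSq_eq_norm_sq (gaussParam z q)
    rw [normSq_apply, ← pow_two, ← pow_two, hN] at h2
    have h3 : (1 - s) / (1 + s) < 1 := by rw [div_lt_one (by positivity)]; linarith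
    rw [h2] at h3
    nlinarith [norm_nonneg (gaussParam z q)]
  · rw [slopeX, hN, hD, hre]; field_simp
  · rw [slopeY, hN, hD, him]; field_simp

theorem contDiffOn_pd (v : ℝ × ℝ) : ContDiffOn ℝ 1 (fun q => fderiv ℝ z q v) U :=
  (hz.contDiffOn.fderiv_of_isOpen hz.isOpen (by norm_num)).clm_apply contDiffOn_const

theorem contDiffOn_gaussParam : ContDiffOn ℝ 1 (gaussParam z) U := by
  have hx : ContDiffOn ℝ 1 (pdx z) U := contDiffOn_pd hz (1, 0)
  have hy : ContDiffOn ℝ 1 (pdy z) U := contDiffOn_pd hz (0, 1)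
  have hs : ContDiffOn ℝ 1 (fun q => √(1 - pdx z q ^ 2 - pdy z q ^ 2)) U := by
    refine ContDiffOn.sqrt ((contDiffOn_const.sub (hx.pow 2)).sub (hy.pow 2)) fun q hq => ?_
    have := hz.spacelike q hq
    intro h
    linarith
  have hc : ContDiffOn ℝ 1 (fun q => (⟨pdx z q, pdy z q⟩ : ℂ)) U := by
    have := Complex.equivRealProdCLM.symm.contDiff.comp_contDiffOn (hx.prodMk hy)
    exact this
  refine (((contDiffOn_const.add hs).inv fun q hq => ?_).smul hc).neg
  positivity

theorem pd_symm {q : ℝ × ℝ} (hq : q ∈ U) : pdx (pdy z) q = pdy (pdx z) q := by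
  have hcd : ContDiffAt ℝ 2 z q := hz.contDiffOn.contDiffAt (hz.isOpen.mem_nhds hq)
  have hd : DifferentiableAt ℝ (fderiv ℝ z) q :=
    (hcd.fderiv_right (m := 1) (by norm_num)).differentiableAt (by norm_num)
  have h := (hcd.isSymmSndFDerivAt (by simp)) (1, 0) (0, 1)
  have key : ∀ u v : ℝ × ℝ, fderiv ℝ (fun q => fderiv ℝ z q u) q v
      = fderiv ℝ (fderiv ℝ z) q v u := by
    intro u v
    rw [fderiv_clm_apply hd (by fun_prop)]
    simp
  exact (key _ _).trans (h.trans (key _ _).symm)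

theorem gaussCR_gaussParam {q : ℝ × ℝ} (hq : q ∈ U) {L : ℝ × ℝ →L[ℝ] ℂ}
    (hL : HasFDerivAt (gaussParam z) L q) :
    GaussCR (gaussParam z q) (L (1, 0)) (L (0, 1)) := by
  have hn := hz.isOpen.mem_nhds hq
  refine gaussCR_of_equation ?_ ?_ hL (gaussParam_spec hz hq).1 (pd_symm hz hq) (hz.equation q hq)
  · filter_upwards [hn] with a ha using (gaussParam_spec hz ha).2.1
  · filter_upwards [hn] with a ha using (gaussParam_spec hz ha).2.2

/-- The Gauss map depends only on the slopes, and these only on w. -/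
theorem gaussParam_injOn (hg : Set.InjOn (gaussMap z) U) : Set.InjOn (gaussParam z) U := by
  intro a ha b hb hab
  have h1 := (gaussParam_spec hz ha).2
  have h2 := (gaussParam_spec hz hb).2
  rw [hab] at h1
  refine hg ha hb ?_
  rw [gaussMap, gaussMap, h1.1, h1.2, h2.1, h2.2]

end GaussParam

/-! ### Isothermal coordinates and the local representation. -/

/-- A one-form `P dx + Q dy` with `P_y = Q_x` on a convex open set is exact. -/
theorem exists_primitive_of_closed {B : Set (ℝ × ℝ)} (hB : IsOpen B) (hc : Convex ℝ B)
    {P Q : ℝ × ℝ → ℂ} (hP : DifferentiableOn ℝ P B) (hQ : DifferentiableOn ℝ Q B)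
    (h : ∀ q ∈ B, fderiv ℝ P q (0, 1) = fderiv ℝ Q q (1, 0)) :
    ∃ G : ℝ × ℝ → ℂ, ∀ q ∈ B, HasFDerivAt G ((ContinuousLinearMap.fst ℝ ℝ ℝ).smulRight (P q) +
      (ContinuousLinearMap.snd ℝ ℝ ℝ).smulRight (Q q)) q := by
  let l₁ := ContinuousLinearMap.smulRightL ℝ (ℝ × ℝ) ℂ (ContinuousLinearMap.fst ℝ ℝ ℝ)
  let l₂ := ContinuousLinearMap.smulRightL ℝ (ℝ × ℝ) ℂ (ContinuousLinearMap.snd ℝ ℝ ℝ)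
  have hd : ∀ q ∈ B, HasFDerivAt (fun q => l₁ (P q) + l₂ (Q q))
      (l₁.comp (fderiv ℝ P q) + l₂.comp (fderiv ℝ Q q)) q := fun q hq =>
    (l₁.hasFDerivAt.comp q (hP.differentiableAt (hB.mem_nhds hq)).hasFDerivAt).add
      (l₂.hasFDerivAt.comp q (hQ.differentiableAt (hB.mem_nhds hq)).hasFDerivAt)
  have hω : DifferentiableOn ℝ (fun q => l₁ (P q) + l₂ (Q q)) B := fun q hq =>
    (hd q hq).differentiableAt.differentiableWithinAt
  have hsymm : ∀ q ∈ B, ∀ x y, fderiv ℝ (fun q => l₁ (P q) + l₂ (Q q)) q x y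
      = fderiv ℝ (fun q => l₁ (P q) + l₂ (Q q)) q y x := by
    intro q hq x y
    rw [(hd q hq).fderiv]
    have e : ∀ (A : ℝ × ℝ →L[ℝ] ℂ) (x : ℝ × ℝ), A x = x.1 * A (1, 0) + x.2 * A (0, 1) := by
      intro A x
      conv_lhs => rw [show x = x.1 • ((1 : ℝ), (0 : ℝ)) + x.2 • ((0 : ℝ), (1 : ℝ)) by ext <;> simp]
      rw [map_add, map_smul, map_smul]
      simp
    have key : ∀ x y : ℝ × ℝ, (l₁.comp (fderiv ℝ P q) + l₂.comp (fderiv ℝ Q q)) x y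
        = y.1 * fderiv ℝ P q x + y.2 * fderiv ℝ Q q x := by
      intro x y
      simp [l₁, l₂]
    rw [key, key, e _ x, e (fderiv ℝ Q q) x, e _ y, e (fderiv ℝ Q q) y, h q hq]
    ring
  exact hc.exists_forall_hasFDerivAt_of_fderiv_symmetric hB hω hsymm

/-- The coefficient of `dx` in the conformal one-form `M dw`. -/
def conformalX (w : ℂ) : ℂ :=
  (1 - (starRingEnd ℂ w) ^ 2) / (1 - w ^ 2 * (starRingEnd ℂ w) ^ 2)

/-- The coefficient of `dy` in the conformal one-form `M dw`. -/
def conformalY (w : ℂ) : ℂ :=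
  -I * (1 + (starRingEnd ℂ w) ^ 2) / (1 - w ^ 2 * (starRingEnd ℂ w) ^ 2)

theorem hasDerivAt_conformal {f : ℝ → ℂ} {f' : ℂ} {t : ℝ} (hf : HasDerivAt f f' t)
    (hn : ‖f t‖ < 1) :
    HasDerivAt (fun t => conformalX (f t))
      ((2 * f t * (starRingEnd ℂ (f t)) ^ 2 * (1 - (starRingEnd ℂ (f t)) ^ 2) * f'
        - 2 * starRingEnd ℂ (f t) * (1 - f t ^ 2) * starRingEnd ℂ f')
        / (1 - f t ^ 2 * (starRingEnd ℂ (f t)) ^ 2) ^ 2) t ∧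
    HasDerivAt (fun t => conformalY (f t))
      (-I * (2 * f t * (starRingEnd ℂ (f t)) ^ 2 * (1 + (starRingEnd ℂ (f t)) ^ 2) * f'
        + 2 * starRingEnd ℂ (f t) * (1 + f t ^ 2) * starRingEnd ℂ f')
        / (1 - f t ^ 2 * (starRingEnd ℂ (f t)) ^ 2) ^ 2) t := by
  have hN := one_sub_sq_mul_conj_sq_ne_zero hn
  have hg : HasDerivAt (fun t => starRingEnd ℂ (f t)) (starRingEnd ℂ f') t :=
    (conjCLE.toContinuousLinearMap.hasFDerivAt (x := f t)).comp_hasDerivAt t hf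
  have hD := ((hf.fun_pow 2).fun_mul (hg.fun_pow 2)).const_sub 1
  constructor
  · refine (((hg.fun_pow 2).const_sub 1).fun_div hD hN).congr_deriv ?_
    congr 1
    push_cast
    ring
  · refine ((((hg.fun_pow 2).const_add 1).const_mul (-I)).fun_div hD hN).congr_deriv ?_
    congr 1
    push_cast
    ring

section LocalRepresentation

variable {U : Set (ℝ × ℝ)} {z : ℝ × ℝ → ℝ} (hz : IsMaximalGraph U z)

include hz

/-- The conformal one-form of a maximal graph is closed, hence locally exact: its primitive is an
isothermal coordinate. -/
theorem exists_conformal_primitive {B : Set (ℝ × ℝ)} (hB : IsOpen B) (hc : Convex ℝ B)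
    (hBU : B ⊆ U) :
    ∃ G : ℝ × ℝ → ℂ, ∀ q ∈ B, HasFDerivAt G (weDiffInv (gaussParam z q) 1) q := by
  have hw : ∀ q ∈ B, DifferentiableAt ℝ (gaussParam z) q := fun q hq =>
    ((contDiffOn_gaussParam hz).contDiffAt (hz.isOpen.mem_nhds (hBU hq))).differentiableAt
      one_ne_zero
  have hconj : ∀ q ∈ B, DifferentiableAt ℝ (fun q => starRingEnd ℂ (gaussParam z q)) q :=
    fun q hq => (conjCLE.toContinuousLinearMap.differentiableAt).comp q (hw q hq)
  have hX : ∀ q ∈ B, DifferentiableAt ℝ (fun q => conformalX (gaussParam z q)) q := fun q hq =>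
    (((hconj q hq).fun_pow 2).const_sub 1).fun_mul
      ((((hw q hq).fun_pow 2).fun_mul ((hconj q hq).fun_pow 2)).const_sub 1 |>.fun_inv
        (one_sub_sq_mul_conj_sq_ne_zero (gaussParam_spec hz (hBU hq)).1))
  have hY : ∀ q ∈ B, DifferentiableAt ℝ (fun q => conformalY (gaussParam z q)) q := fun q hq =>
    ((((hconj q hq).fun_pow 2).const_add 1).const_mul (-I)).fun_mul
      ((((hw q hq).fun_pow 2).fun_mul ((hconj q hq).fun_pow 2)).const_sub 1 |>.fun_inv
        (one_sub_sq_mul_conj_sq_ne_zero (gaussParam_spec hz (hBU hq)).1))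
  obtain ⟨G, hG⟩ := exists_primitive_of_closed hB hc
    (P := fun q => conformalX (gaussParam z q)) (Q := fun q => conformalY (gaussParam z q))
    (fun q hq => (hX q hq).differentiableWithinAt) (fun q hq => (hY q hq).differentiableWithinAt)
    (by
      intro q hq
      have hL := (hw q hq).hasFDerivAt
      set L := fderiv ℝ (gaussParam z) q
      have hcr := gaussCR_gaussParam hz (hBU hq) hL
      have hline : ∀ v, HasDerivAt (fun t : ℝ => gaussParam z (q + t • v)) (L v) 0 := fun v =>
        hL.hasLineDerivAt v
      have h1 := (hasDerivAt_conformal (hline (0, 1))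
        (by simpa using (gaussParam_spec hz (hBU hq)).1)).1
      have h2 := (hasDerivAt_conformal (hline (1, 0))
        (by simpa using (gaussParam_spec hz (hBU hq)).1)).2
      rw [((hX q hq).hasFDerivAt.hasLineDerivAt (0, 1)).unique h1,
        ((hY q hq).hasFDerivAt.hasLineDerivAt (1, 0)).unique h2]
      simp only [zero_smul, add_zero]
      congr 1
      -- The derivatives of the coefficients involve both dw and its conjugate, so closedness
      -- combines the Cauchy–Riemann equation with its conjugate.
      have hcr' := congrArg (starRingEnd ℂ) hcr
      rw [GaussCR] at hcr
      simp only [map_add, map_mul, map_sub, map_one, map_pow, conj_I, conj_conj, map_zero] at hcr'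
      linear_combination 2 * gaussParam z q * (starRingEnd ℂ (gaussParam z q)) ^ 2 * hcr
        - 2 * starRingEnd ℂ (gaussParam z q) * hcr')
  refine ⟨G, fun q hq => (hG q hq).congr_fderiv ?_⟩
  simp only [weDiffInv, conformalX, conformalY, div_one]

/-- In an isothermal coordinate the Gauss parameter is holomorphic. -/
theorem differentiableAt_gaussParam_comp {S : ℂ → ℝ × ℝ} {ξ : ℂ} (hS : S ξ ∈ U)
    (hd : HasFDerivAt S (weDiff (gaussParam z (S ξ)) 1) ξ) :
    DifferentiableAt ℂ (fun ξ => gaussParam z (S ξ)) ξ := by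
  have hw : DifferentiableAt ℝ (gaussParam z) (S ξ) :=
    ((contDiffOn_gaussParam hz).contDiffAt (hz.isOpen.mem_nhds hS)).differentiableAt one_ne_zero
  have hL := hw.hasFDerivAt
  have hcr := gaussCR_gaussParam hz hS hL
  set L := fderiv ℝ (gaussParam z) (S ξ)
  have hcomp : HasFDerivAt (fun ξ => gaussParam z (S ξ)) (L.comp (weDiff (gaussParam z (S ξ)) 1)) ξ :=
    hL.comp ξ hd
  rw [differentiableAt_complex_iff_differentiableAt_real]
  refine ⟨hcomp.differentiableAt, ?_⟩
  rw [hcomp.fderiv, ContinuousLinearMap.comp_apply, ContinuousLinearMap.comp_apply, weDiff_apply,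
    weDiff_apply]
  have e : ∀ a b : ℝ, L (a, b) = a * L (1, 0) + b * L (0, 1) := by
    intro a b
    conv_lhs => rw [show (a, b) = a • ((1 : ℝ), (0 : ℝ)) + b • ((0 : ℝ), (1 : ℝ)) by ext <;> simp]
    rw [map_add, map_smul, map_smul]
    simp
  rw [GaussCR] at hcr
  generalize gaussParam z (S ξ) = w at *
  refine (e _ _).trans (Eq.trans ?_ (congrArg (I * ·) (e _ _)).symm)
  rw [re_eq_add_conj, re_eq_add_conj, re_eq_add_conj, re_eq_add_conj]
  simp only [map_mul, map_add, map_sub, map_one, map_pow, conj_I]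
  linear_combination -hcr + ((1 - (starRingEnd ℂ w) ^ 2) * L (0, 1)) * I_sq

/-- Near every point, a maximal graph with injective Gauss map is parametrized by the Gauss
parameter `ζ`, and the parametrization is of Weierstrass-Enneper type. -/
theorem exists_local_representation (hg : Set.InjOn (gaussMap z) U) {p : ℝ × ℝ} (hp : p ∈ U) :
    ∃ r > 0, ∃ (M : ℂ → ℂ) (T : ℂ → ℝ × ℝ), T (gaussParam z p) = p ∧
      DifferentiableOn ℂ M (Metric.ball (gaussParam z p) r) ∧
      ∀ ζ ∈ Metric.ball (gaussParam z p) r, M ζ ≠ 0 ∧ ‖ζ‖ < 1 ∧ T ζ ∈ U ∧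
        gaussParam z (T ζ) = ζ ∧ HasFDerivAt T (weDiff ζ (M ζ)) ζ := by
  obtain ⟨ε, hε, hεU⟩ := Metric.isOpen_iff.1 hz.isOpen p hp
  set B := Metric.ball p ε
  have hpB : p ∈ B := Metric.mem_ball_self hε
  obtain ⟨G, hG⟩ := exists_conformal_primitive hz Metric.isOpen_ball (convex_ball p ε) hεU
  have hGe : ∀ q (hq : q ∈ B), HasFDerivAt G
      ((weEquiv (gaussParam_spec hz (hεU hq)).1 one_ne_zero).symm : ℝ × ℝ →L[ℝ] ℂ) q := by
    intro q hq
    rw [weEquiv_symm_coe]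
    exact hG q hq
  have hcont : ContinuousOn (fun q => weDiffInv (gaussParam z q) 1) B := by
    have hw : ContinuousOn (gaussParam z) B := (contDiffOn_gaussParam hz).continuousOn.mono hεU
    have hcj : ContinuousOn (fun q => starRingEnd ℂ (gaussParam z q)) B :=
      continuous_conj.comp_continuousOn hw
    have hN : ContinuousOn
        (fun q => 1 - gaussParam z q ^ 2 * (starRingEnd ℂ (gaussParam z q)) ^ 2) B :=
      continuousOn_const.sub ((hw.pow 2).mul (hcj.pow 2))
    have hN0 : ∀ q ∈ B, 1 - gaussParam z q ^ 2 * (starRingEnd ℂ (gaussParam z q)) ^ 2 ≠ 0 :=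
      fun q hq => one_sub_sq_mul_conj_sq_ne_zero (gaussParam_spec hz (hεU hq)).1
    have h1 := (((continuousOn_const (c := (1 : ℂ))).sub (hcj.pow 2)).div hN hN0).div_const 1
    have h2 := (((continuousOn_const (c := -I)).mul
      ((continuousOn_const (c := (1 : ℂ))).add (hcj.pow 2))).div hN hN0).div_const 1
    exact ((ContinuousLinearMap.smulRightL ℝ (ℝ × ℝ) ℂ
        (ContinuousLinearMap.fst ℝ ℝ ℝ)).continuous.comp_continuousOn h1).add
      ((ContinuousLinearMap.smulRightL ℝ (ℝ × ℝ) ℂ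
        (ContinuousLinearMap.snd ℝ ℝ ℝ)).continuous.comp_continuousOn h2)
  have hstrict : HasStrictFDerivAt G
      ((weEquiv (gaussParam_spec hz hp).1 one_ne_zero).symm : ℝ × ℝ →L[ℝ] ℂ) p := by
    rw [weEquiv_symm_coe]
    refine hasStrictFDerivAt_of_hasFDerivAt_of_continuousAt
      (f' := fun q => weDiffInv (gaussParam z q) 1) ?_
      (hcont.continuousAt (Metric.isOpen_ball.mem_nhds hpB))
    filter_upwards [Metric.isOpen_ball.mem_nhds hpB] with q hq using hG q hq
  let e := (hstrict.toOpenPartialHomeomorph G).restrOpen B Metric.isOpen_ball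
  have hpe : p ∈ e.source := ⟨hstrict.mem_toOpenPartialHomeomorph_source, hpB⟩
  have heB : ∀ ξ ∈ e.target, e.symm ξ ∈ B := fun ξ hξ => (e.map_target hξ).2
  have heG : ∀ q, e q = G q := fun q => rfl
  have hed : ∀ ξ ∈ e.target, HasFDerivAt e.symm (weDiff (gaussParam z (e.symm ξ)) 1) ξ := by
    intro ξ hξ
    have := e.hasFDerivAt_symm hξ (hGe _ (heB ξ hξ))
    rwa [ContinuousLinearEquiv.symm_symm, weEquiv_coe] at this
  -- The Gauss parameter in the isothermal coordinate: holomorphic and injective, so its local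
  -- inverse κ is holomorphic.
  let ψ : ℂ → ℂ := fun ξ => gaussParam z (e.symm ξ)
  have hψ : DifferentiableOn ℂ ψ e.target := fun ξ hξ =>
    (differentiableAt_gaussParam_comp hz (hεU (heB ξ hξ)) (hed ξ hξ)).differentiableWithinAt
  have hψi : Set.InjOn ψ e.target := fun a ha b hb hab =>
    e.symm.injOn ha hb (gaussParam_injOn hz hg (hεU (heB a ha)) (hεU (heB b hb)) hab)
  have hψ' : ∀ ξ ∈ e.target, deriv ψ ξ ≠ 0 := fun ξ hξ =>
    deriv_ne_zero_of_injOn e.open_target hψ hψi hξ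
  have hψa : ∀ ξ ∈ e.target, AnalyticAt ℂ ψ ξ := fun ξ hξ =>
    hψ.analyticAt (e.open_target.mem_nhds hξ)
  have hGp : G p ∈ e.target := e.map_source hpe
  have hψp : ψ (G p) = gaussParam z p := congrArg (gaussParam z) (e.left_inv hpe)
  have hs := (hψa _ hGp).hasStrictDerivAt
  let κ := hs.localInverse ψ _ _ (hψ' _ hGp)
  have hκa : AnalyticAt ℂ κ (gaussParam z p) :=
    hψp ▸ (hψa _ hGp).analyticAt_localInverse (hψ' _ hGp)
  have hκ0 : κ (gaussParam z p) = G p := by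
    rw [← hψp]
    exact HasStrictFDerivAt.localInverse_apply_image ..
  have hright : ∀ᶠ ζ in 𝓝 (gaussParam z p), ψ (κ ζ) = ζ := by
    rw [← hψp]
    exact HasStrictDerivAt.eventually_right_inverse ..
  have htar : ∀ᶠ ζ in 𝓝 (gaussParam z p), κ ζ ∈ e.target :=
    hκa.continuousAt.eventually_mem (hκ0.symm ▸ e.open_target.mem_nhds hGp)
  have hlt : ∀ᶠ ζ in 𝓝 (gaussParam z p), ‖ζ‖ < 1 :=
    continuous_norm.continuousAt.eventually_lt_const (gaussParam_spec hz hp).1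
  obtain ⟨r, hr, hball⟩ := Metric.eventually_nhds_iff_ball.1
    (((hright.and htar).and hlt).and hκa.eventually_analyticAt)
  -- By the chain rule, passing from the coordinate ξ to ζ multiplies the density 1 by κ'; κ' ≠ 0
  -- because ψ ∘ κ = id.
  refine ⟨r, hr, deriv κ, fun ζ => e.symm (κ ζ), ?_, ?_, fun ζ hζ => ?_⟩
  · dsimp only
    rw [hκ0]
    exact e.left_inv hpe
  · exact fun ζ hζ => (hball ζ hζ).2.deriv.differentiableAt.differentiableWithinAt
  · obtain ⟨⟨⟨h1, h2⟩, h3⟩, h4⟩ := hball ζ hζ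
    refine ⟨?_, h3, hεU (heB _ h2), h1, ?_⟩
    · intro h0
      have hid : HasDerivAt (fun ζ => ψ (κ ζ)) (deriv ψ (κ ζ) * deriv κ ζ) ζ :=
        (hψa _ h2).differentiableAt.hasDerivAt.comp ζ h4.differentiableAt.hasDerivAt
      have hone : HasDerivAt (fun ζ => ψ (κ ζ)) 1 ζ := by
        refine (hasDerivAt_id ζ).congr_of_eventuallyEq ?_
        filter_upwards [Metric.isOpen_ball.mem_nhds hζ] with a ha using (hball a ha).1.1.1
      have := hid.unique hone
      rw [h0, mul_zero] at this
      exact zero_ne_one this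
    · have h := (hed _ h2).comp ζ h4.differentiableAt.hasDerivAt.complexToReal_fderiv
      refine h.congr_fderiv ?_
      rw [show gaussParam z (e.symm (κ ζ)) = ζ from h1]
      ext v <;> simp [weDiff_apply, mul_assoc]

end LocalRepresentation

/-! ### Splitting the data within the associated family. -/

section Decomposition

variable {Ω : Set ℂ} {M : ℂ → ℂ} {ζ₀ : ℂ} (ho : IsOpen Ω) (hc : Convex ℝ Ω) (h₀ : ζ₀ ∈ Ω)
  (hM : DifferentiableOn ℂ M Ω)

include ho hc h₀ hM

/-- Splitting `M` into complex multiples of itself decomposes a maximal surface into members of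
its associated family. -/
theorem isWEDecomposition_of_sum_eq_one (hw : ∀ ζ ∈ Ω, ‖ζ‖ < 1) {u : ℂ} {κ₁ κ₂ : ℝ}
    (h1 : ∀ ζ ∈ Ω, ‖M ζ - u‖ ≤ κ₁) (h2 : ∀ ζ ∈ Ω, ‖ζ ^ 2 * M ζ‖ ≤ κ₂) (hκ : κ₁ + κ₂ < ‖u‖)
    (hne : ∀ ζ ∈ Ω, M ζ ≠ 0) {z : ℝ × ℝ → ℝ} {z₀ : ℝ} {Φ : OpenPartialHomeomorph (ℝ × ℝ) ℂ}
    (ht : Φ.target = Ω) (hz : ∀ q ∈ Φ.source, z q = weZ M ζ₀ z₀ (Φ q)) {n : ℕ} (hn : 1 ≤ n)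
    {c : Fin n → ℂ} (hc0 : ∀ i, c i ≠ 0) (hsum : ∑ i, c i = 1) :
    IsWEDecomposition z Φ.source Ω ζ₀ M Φ (fun i q => weZ (fun w => c i * M w) ζ₀ (z₀ / n) (Φ q)) := by
  refine ⟨fun q hq => ?_, fun i w => c i * M w, fun ζ _ => ?_, fun i => ?_⟩
  · have hn0 : (n : ℝ) ≠ 0 := by exact_mod_cast (by omega : n ≠ 0)
    simp only [hz q hq, weZ_const_mul, Finset.sum_add_distrib]
    rw [← Complex.re_sum, ← Finset.sum_mul, hsum, one_mul, weZ]
    simp [mul_div_cancel₀ _ hn0]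
  · rw [← Finset.sum_mul, hsum, one_mul]
  · have hM' : DifferentiableOn ℂ (fun w => c i * M w) Ω := hM.const_mul (c i)
    have hne' : ∀ ζ ∈ Ω, c i * M ζ ≠ 0 := fun ζ hζ => mul_ne_zero (hc0 i) (hne ζ hζ)
    -- Both bounds and the reference value u scale with c i, so the injectivity criterion holds on
    -- the same Ω.
    have hinj : Set.InjOn (weMap (fun w => c i * M w) ζ₀ 0 0) Ω := by
      refine weMap_injOn ho hc h₀ hM' 0 0 (u := c i * u) (κ₁ := ‖c i‖ * κ₁) (κ₂ := ‖c i‖ * κ₂)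
        (fun ζ hζ => ?_) (fun ζ hζ => ?_) ?_
      · rw [← mul_sub, norm_mul]
        exact mul_le_mul_of_nonneg_left (h1 ζ hζ) (norm_nonneg _)
      · rw [mul_left_comm, norm_mul]
        exact mul_le_mul_of_nonneg_left (h2 ζ hζ) (norm_nonneg _)
      · rw [← mul_add, norm_mul]
        exact mul_lt_mul_of_pos_left hκ (norm_pos_iff.2 (hc0 i))
    obtain ⟨Φi, hti, hsi, hdi, hcdi⟩ := exists_chart_weMap ho hc h₀ hM' 0 0 hw hne' hinj
    have hr : ∀ ζ ∈ Ω, Φi (Φi.symm ζ) = ζ := fun ζ hζ => Φi.right_inv (hti.symm ▸ hζ)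
    refine ⟨0, 0, z₀ / n, Φi.source, fun q => weZ (fun w => c i * M w) ζ₀ (z₀ / n) (Φi q), Φi,
      isMaximalGraph_weZ ho hc h₀ hM' _ hw hne' hti hdi hcdi, ?_, fun q hq => ?_⟩
    · exact
        { isOpen := ho
          convex := hc
          base_mem := h₀
          holomorphic := hM'
          ne_zero := hne'
          source_eq := rfl
          target_eq := hti
          smooth := hcdi
          smooth_symm := by rw [hsi]; exact contDiffOn_weMap ho hc h₀ hM' 0 0
          coord_x := fun ζ _ => by rw [hsi]; rfl
          coord_y := fun ζ _ => by rw [hsi]; rfl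
          height := fun ζ hζ => by rw [hr ζ hζ] }
    · dsimp only
      rw [hr _ (ht ▸ Φ.map_source hq)]

/-- The heights of two members of the associated family are affinely related only if the
corresponding factors are real multiples of each other. -/
theorem eq_mul_of_weZ_affine (hne : ∀ ζ ∈ Ω, M ζ ≠ 0) {c c' : ℂ} {s s' a b : ℝ}
    (h : ∀ ζ ∈ Ω, weZ (fun w => c * M w) ζ₀ s ζ = a * weZ (fun w => c' * M w) ζ₀ s' ζ + b) :
    c = a * c' := by
  by_contra hcc
  have hk : c - a * c' ≠ 0 := sub_ne_zero.2 hcc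
  have hconst : ∀ ζ ∈ Ω, weZ (fun w => (c - a * c') * M w) ζ₀ 0 ζ = a * s' + b - s := by
    intro ζ hζ
    have := h ζ hζ
    rw [weZ_const_mul, weZ_const_mul] at this
    rw [weZ_const_mul, sub_mul, sub_re, mul_assoc, re_ofReal_mul]
    linarith
  -- A constant height has zero differential -2ζ(c - a c')M(ζ) dζ, which forces ζ = 0; no nonempty
  -- open set is so small.
  have hzero : ∀ ζ ∈ Ω, ζ = 0 := by
    intro ζ hζ
    have hd := hasFDerivAt_weZ ho hc h₀ (hM.const_mul (c - a * c')) 0 hζ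
    have hd0 : HasFDerivAt (weZ (fun w => (c - a * c') * M w) ζ₀ 0) (0 : ℂ →L[ℝ] ℝ) ζ := by
      refine (hasFDerivAt_const (a * s' + b - s) ζ).congr_of_eventuallyEq ?_
      filter_upwards [ho.mem_nhds hζ] with ξ hξ using hconst ξ hξ
    have he := hd.unique hd0
    have e1 := DFunLike.congr_fun he 1
    have e2 := DFunLike.congr_fun he I
    simp only [ContinuousLinearMap.comp_apply, smul_apply, ContinuousLinearMap.id_apply,
      smul_eq_mul, mul_one, reCLM_apply, mul_I_re, zero_apply, neg_eq_zero] at e1 e2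
    have hy : -2 * ζ * ((c - a * c') * M ζ) = 0 := Complex.ext e1 e2
    by_contra hζ0
    exact mul_ne_zero (mul_ne_zero (by norm_num) hζ0) (mul_ne_zero hk (hne ζ hζ)) hy
  have hev : ∀ᶠ ζ in 𝓝[≠] ζ₀, False := by
    filter_upwards [nhdsWithin_le_nhds (ho.mem_nhds h₀), self_mem_nhdsWithin] with ζ hζ hζ'
    exact hζ' ((hzero ζ hζ).trans (hzero ζ₀ h₀).symm)
  exact hev.exists.elim fun _ => id

end Decomposition

/-- There are `n ≥ 2` non-real numbers with real part `1 / n` and sum `1`. -/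
theorem exists_nonreal_sum_eq_one {n : ℕ} (hn : 2 ≤ n) :
    ∃ t : Fin n → ℝ, (∀ i, t i ≠ 0) ∧ ∑ i, ((1 / n : ℂ) + t i * I) = 1 := by
  have hn0 : (n : ℂ) ≠ 0 := by exact_mod_cast (by omega : n ≠ 0)
  -- All t i are 1 except the first, which is 1 - n: the sum is 0, and 1 - n ≠ 0 since n ≥ 2.
  refine ⟨fun i => 1 - if i = ⟨0, by omega⟩ then (n : ℝ) else 0, fun i => ?_, ?_⟩
  · dsimp only
    split_ifs
    · have : (2 : ℝ) ≤ n := by exact_mod_cast hn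
      intro h
      linarith
    · norm_num
  · rw [Finset.sum_add_distrib, ← Finset.sum_mul, ← Complex.ofReal_sum]
    simp [Finset.sum_sub_distrib, hn0]

end MaximalSurface

end

/-! ### Proof of the theorem. -/

open MaximalSurface Filter Topology in
theorem theorem3p2 (U : Set (ℝ × ℝ)) (z : ℝ × ℝ → ℝ)
    (hz : MaximalSurface.IsMaximalGraph U z)
    (hg : Set.InjOn (MaximalSurface.gaussMap z) U)
    (p : ℝ × ℝ) (hp : p ∈ U) (n : ℕ) (hn : 1 ≤ n) :
    ∃ U' : Set (ℝ × ℝ), IsOpen U' ∧ p ∈ U' ∧ U' ⊆ U ∧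
      ∃ (Ω : Set ℂ) (ζ₀ : ℂ) (M : ℂ → ℂ) (x₀ y₀ z₀ : ℝ)
        (Φ : OpenPartialHomeomorph (ℝ × ℝ) ℂ),
        MaximalSurface.IsWERep Ω ζ₀ M x₀ y₀ z₀ U' z Φ ∧
        (∃ zs : Fin n → ℝ × ℝ → ℝ, MaximalSurface.IsWEDecomposition z U' Ω ζ₀ M Φ zs) ∧
        (2 ≤ n → ∃ zs zs' : Fin n → ℝ × ℝ → ℝ,
          MaximalSurface.IsWEDecomposition z U' Ω ζ₀ M Φ zs ∧
          MaximalSurface.IsWEDecomposition z U' Ω ζ₀ M Φ zs' ∧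
          ∀ i j, ¬ ∃ a b : ℝ, ∀ q ∈ U', zs i q = a * zs' j q + b) := by
  obtain ⟨r, hr, M, T, hTp, hM₀, hT⟩ := exists_local_representation hz hg hp
  set w₀ := gaussParam z p
  have hw₀ : ‖w₀‖ < 1 := (gaussParam_spec hz hp).1
  have hu : 0 < ‖M w₀‖ := norm_pos_iff.2 (hT w₀ (Metric.mem_ball_self hr)).1
  have hMc : ContinuousAt M w₀ :=
    hM₀.continuousOn.continuousAt (Metric.isOpen_ball.mem_nhds (Metric.mem_ball_self hr))
  have hsq : ‖w₀‖ ^ 2 < 1 := pow_lt_one₀ (norm_nonneg _) hw₀ two_ne_zero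
  -- At w₀ the left sides here and in `hev₂` are 0 and ‖w₀‖²‖M w₀‖. The chosen margins add up to (3
  -- + ‖w₀‖²)/4 · ‖M w₀‖ < ‖M w₀‖, as `weMap_injOn` needs.
  have hev₁ : ∀ᶠ ζ in 𝓝 w₀, ‖M ζ - M w₀‖ < (1 - ‖w₀‖ ^ 2) / 4 * ‖M w₀‖ := by
    refine (hMc.sub continuousAt_const).norm.eventually_lt_const ?_
    change ‖M w₀ - M w₀‖ < _
    rw [sub_self, norm_zero]
    exact mul_pos (by linarith) hu
  have hev₂ : ∀ᶠ ζ in 𝓝 w₀, ‖ζ ^ 2 * M ζ‖ < (1 + ‖w₀‖ ^ 2) / 2 * ‖M w₀‖ := by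
    refine ((continuousAt_id.pow 2).mul hMc).norm.eventually_lt_const ?_
    change ‖w₀ ^ 2 * M w₀‖ < _
    rw [norm_mul, norm_pow]
    exact mul_lt_mul_of_pos_right (by linarith) hu
  obtain ⟨ρ, hρ, hball⟩ := Metric.eventually_nhds_iff_ball.1
    ((hev₁.and hev₂).and (Metric.isOpen_ball.mem_nhds (Metric.mem_ball_self hr)))
  set Ω := Metric.ball w₀ ρ
  have ho : IsOpen Ω := Metric.isOpen_ball
  have hc : Convex ℝ Ω := convex_ball w₀ ρ
  have h₀ : w₀ ∈ Ω := Metric.mem_ball_self hρ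
  have hM : DifferentiableOn ℂ M Ω := hM₀.mono fun ζ hζ => (hball ζ hζ).2
  have h1 : ∀ ζ ∈ Ω, ‖M ζ - M w₀‖ ≤ (1 - ‖w₀‖ ^ 2) / 4 * ‖M w₀‖ :=
    fun ζ hζ => (hball ζ hζ).1.1.le
  have h2 : ∀ ζ ∈ Ω, ‖ζ ^ 2 * M ζ‖ ≤ (1 + ‖w₀‖ ^ 2) / 2 * ‖M w₀‖ :=
    fun ζ hζ => (hball ζ hζ).1.2.le
  have hκ : (1 - ‖w₀‖ ^ 2) / 4 * ‖M w₀‖ + (1 + ‖w₀‖ ^ 2) / 2 * ‖M w₀‖ < ‖M w₀‖ := by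
    rw [← add_mul]
    exact mul_lt_of_lt_one_left hu (by linarith)
  have hT' : ∀ ζ ∈ Ω, M ζ ≠ 0 ∧ ‖ζ‖ < 1 ∧ T ζ ∈ U ∧
      gaussParam z (T ζ) = ζ ∧ HasFDerivAt T (weDiff ζ (M ζ)) ζ := fun ζ hζ => hT ζ (hball ζ hζ).2
  have hne : ∀ ζ ∈ Ω, M ζ ≠ 0 := fun ζ hζ => (hT' ζ hζ).1
  have hw : ∀ ζ ∈ Ω, ‖ζ‖ < 1 := fun ζ hζ => (hT' ζ hζ).2.1
  obtain ⟨Φ, ht, hs, hd, hcd⟩ := exists_chart_weMap ho hc h₀ hM p.1 p.2 hw hne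
    (weMap_injOn ho hc h₀ hM p.1 p.2 h1 h2 hκ)
  -- Same differential on a connected set and same value p at w₀; the heights are compared likewise
  -- in `hzT`.
  have hTF : Set.EqOn (weMap M w₀ p.1 p.2) T Ω := by
    have hF := fun ζ (hζ : ζ ∈ Ω) => hasFDerivAt_weMap ho hc h₀ hM p.1 p.2 hζ
    refine ho.eqOn_of_fderiv_eq hc.isPreconnected
      (fun ζ hζ => (hF ζ hζ).differentiableAt.differentiableWithinAt)
      (fun ζ hζ => (hT' ζ hζ).2.2.2.2.differentiableAt.differentiableWithinAt)
      (fun ζ hζ => ?_) h₀ ?_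
    · rw [(hF ζ hζ).fderiv, (hT' ζ hζ).2.2.2.2.fderiv]
    · rw [weMap_self, hTp]
  have hzT : Set.EqOn (fun ζ => z (T ζ)) (weZ M w₀ (z p)) Ω := by
    have hzd : ∀ ζ ∈ Ω, HasFDerivAt (fun ζ => z (T ζ))
        (Complex.reCLM.comp ((-2 * ζ * M ζ) • ContinuousLinearMap.id ℝ ℂ)) ζ := by
      intro ζ hζ
      obtain ⟨-, -, hU, hg, hTd⟩ := hT' ζ hζ
      have hzd : HasFDerivAt z (fderiv ℝ z (T ζ)) (T ζ) :=
        ((hz.contDiffOn.contDiffAt (hz.isOpen.mem_nhds hU)).differentiableAt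
          two_ne_zero).hasFDerivAt
      refine (hzd.comp ζ hTd).congr_fderiv (ContinuousLinearMap.ext fun v => ?_)
      obtain ⟨-, hx, hy⟩ := gaussParam_spec hz hU
      rw [hg] at hx hy
      have hv := height_diff ζ (M ζ) v
      rw [← hx, ← hy] at hv
      simp only [ContinuousLinearMap.comp_apply, smul_apply, ContinuousLinearMap.id_apply,
        smul_eq_mul, Complex.reCLM_apply]
      rw [← hv, pdx, pdy]
      generalize weDiff ζ (M ζ) v = x
      conv_lhs =>
        rw [show x = x.1 • ((1 : ℝ), (0 : ℝ)) + x.2 • ((0 : ℝ), (1 : ℝ)) by ext <;> simp]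
      rw [map_add, map_smul, map_smul, smul_eq_mul, smul_eq_mul, mul_comm, mul_comm x.2]
    have hZ := fun ζ (hζ : ζ ∈ Ω) => hasFDerivAt_weZ ho hc h₀ hM (z p) hζ
    refine ho.eqOn_of_fderiv_eq hc.isPreconnected
      (fun ζ hζ => (hzd ζ hζ).differentiableAt.differentiableWithinAt)
      (fun ζ hζ => (hZ ζ hζ).differentiableAt.differentiableWithinAt)
      (fun ζ hζ => ?_) h₀ ?_
    · rw [(hzd ζ hζ).fderiv, (hZ ζ hζ).fderiv]
    · simp only [weZ_self, hTp]
  have hmem : ∀ q ∈ Φ.source, Φ q ∈ Ω := fun q hq => ht ▸ Φ.map_source hq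
  have hTΦ : ∀ q ∈ Φ.source, T (Φ q) = q := fun q hq => by
    rw [← hTF (hmem q hq), ← hs, Φ.left_inv hq]
  have hzΦ : ∀ q ∈ Φ.source, z q = weZ M w₀ (z p) (Φ q) := fun q hq => by
    rw [← hzT (hmem q hq)]
    simp only [hTΦ q hq]
  have hn0 : (n : ℂ) ≠ 0 := by exact_mod_cast (by omega : n ≠ 0)
  have hdec := isWEDecomposition_of_sum_eq_one ho hc h₀ hM hw h1 h2 hκ hne ht hzΦ hn
    (c := fun _ => 1 / n) (fun _ => one_div_ne_zero hn0) (by simp [hn0])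
  refine ⟨Φ.source, Φ.open_source, ?_, fun q hq => ?_, Ω, w₀, M, p.1, p.2, z p, Φ, ?_,
    ⟨_, hdec⟩, fun hn2 => ?_⟩
  · have := Φ.map_target (ht.symm ▸ h₀)
    rwa [hs, weMap_self] at this
  · rw [← hTΦ q hq]
    exact (hT' _ (hmem q hq)).2.2.1
  · exact
      { isOpen := ho
        convex := hc
        base_mem := h₀
        holomorphic := hM
        ne_zero := hne
        source_eq := rfl
        target_eq := ht
        smooth := hcd
        smooth_symm := by rw [hs]; exact contDiffOn_weMap ho hc h₀ hM p.1 p.2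
        coord_x := fun ζ _ => by rw [hs]; rfl
        coord_y := fun ζ _ => by rw [hs]; rfl
        height := fun ζ hζ => by rw [hs, hTF hζ]; exact hzT hζ }
  · obtain ⟨t, ht0, hts⟩ := exists_nonreal_sum_eq_one hn2
    have him : ∀ i, ((1 / n : ℂ) + t i * Complex.I).im = t i := fun i => by
      rw [show (1 / n : ℂ) = ((1 / n : ℝ) : ℂ) by push_cast; rfl]
      simp [-one_div, -Complex.ofReal_div, -Complex.ofReal_inv]
    have hdec' := isWEDecomposition_of_sum_eq_one ho hc h₀ hM hw h1 h2 hκ hne ht hzΦ hn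
      (c := fun i => 1 / n + t i * Complex.I)
      (fun i h => ht0 i (by rw [← him i, h, Complex.zero_im])) hts
    refine ⟨_, _, hdec, hdec', fun i j => ?_⟩
    rintro ⟨a, b, hab⟩
    have heq := eq_mul_of_weZ_affine ho hc h₀ hM hne (a := a) (b := b) (c := 1 / n)
      (c' := 1 / n + t j * Complex.I) (s := z p / n) (s' := z p / n) fun ζ hζ => by
        have := hab (Φ.symm ζ) (Φ.map_target (ht.symm ▸ hζ))
        rwa [Φ.right_inv (ht.symm ▸ hζ)] at this
    have h3 := congrArg Complex.im heq
    rw [Complex.im_ofReal_mul, him,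
      show (1 / n : ℂ) = ((1 / n : ℝ) : ℂ) by push_cast; rfl, Complex.ofReal_im] at h3
    -- 1/n is real while the other factor is not, so the real ratio a vanishes and 1/n = 0.
    have ha : a = 0 := (mul_eq_zero.1 h3.symm).resolve_right (ht0 j)
    rw [ha, Complex.ofReal_zero, zero_mul] at heq
    exact one_div_ne_zero hn0 heq
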